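/- Let $\ell>0$, $\xi\in(-\ell,\ell)$, $a_+<0<a_-$, and let $a^0(x)=a_-$ for $x<\xi$, $a^0(x)=a_+$ for $x>\xi$. Let $\varepsilon_1>0$ and, for $0<\varepsilon<\varepsilon_1$, let $a^\varepsilon\in C^0([-\ell,\ell])$ be real functions such that: **A1.** $a^\varepsilon$ is twice differentiable at every $x\in(-\ell,\ell)$, $x\neq\xi$, with $$\frac{da^\varepsilon}{dx},\ \frac{d^2a^\varepsilon}{dx^2}<0<a^\varepsilon\ \text{ in }(-\ell,\xi),\qquad a^\varepsilon,\ \frac{da^\varepsilon}{dx}<0<\frac{d^2a^\varepsilon}{dx^2}\ \text{ in }(\xi,\ell).$$ **A2.** For every $C>0$ there is $c_0>0$ such that, for all $\varepsilon\in(0,\varepsilon_1)$ and all $x\in(-\ell,\ell)$ with $|x-\xi|\ge c_0\varepsilon$, $$|a^\varepsilon(x)-a^0(x)|\le C\qquad\text{and}\qquad \varepsilon\left|\frac{da^\varepsilon}{dx}(x)\right|\le C.$$ **A3.** The left and right derivatives of $a^\varepsilon$ at $\xi$ exist, and $\liminf_{\varepsilon\to0^+}\varepsilon\left|\frac{da^\varepsilon}{dx}(\xi\pm)\right|>0$.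 Consider the operator $\mathcal L^\varepsilon u=\varepsilon u''-(a^\varepsilon u)'$ in $L^2(-\ell,\ell)$ with Dirichlet boundary conditions $u(\pm\ell)=0$, that is, with domain $H^2(-\ell,\ell)\cap H^1_0(-\ell,\ell)$. Then there exist $C>0$ and $\varepsilon_0\in(0,\varepsilon_1]$ such that for every $\varepsilon\in(0,\varepsilon_0)$ the operator $\mathcal L^\varepsilon$ has a second eigenvalue $\lambda_2^\varepsilon$ (its eigenvalues are real, the largest one $\lambda_1^\varepsilon$ is simple, and $\lambda_2^\varepsilon<\lambda_1^\varepsilon$ is the largest of the others), and $$\lambda_2^\varepsilon\le -\frac{C}{\varepsilon}.$$ -/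

import Mathlib

open MeasureTheory Filter Topology Set

noncomputable section

namespace DiffusionTransport

/-- The step function equal to `am` to the left of `ξ` and to `ap` to the right of `ξ`. -/
def stepFunction (ξ am ap : ℝ) (x : ℝ) : ℝ := if x < ξ then am else ap

/-- Hypothesis A1 for one coefficient `a` on `(-ℓ, ℓ)`: twice differentiable away from `ξ`;
positive, decreasing and concave on `(-ℓ, ξ)`; negative, decreasing and convex on `(ξ, ℓ)`,
all inequalities being strict. -/
structure HypA1 (ℓ ξ : ℝ) (a : ℝ → ℝ) : Prop where
  differentiable : ∀ x ∈ Ioo (-ℓ) ℓ, x ≠ ξ → DifferentiableAt ℝ a x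
  twice_differentiable : ∀ x ∈ Ioo (-ℓ) ℓ, x ≠ ξ → DifferentiableAt ℝ (deriv a) x
  left : ∀ x ∈ Ioo (-ℓ) ξ, deriv a x < 0 ∧ deriv (deriv a) x < 0 ∧ 0 < a x
  right : ∀ x ∈ Ioo ξ ℓ, a x < 0 ∧ deriv a x < 0 ∧ 0 < deriv (deriv a) x

/-- Hypothesis A2 for the family `a ε`, `0 < ε < ε₁`. The constant `c₀` depends on `C` only,
not on `ε` and `x`. -/
def HypA2 (ℓ ξ am ap ε₁ : ℝ) (a : ℝ → ℝ → ℝ) : Prop :=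
  ∀ C : ℝ, 0 < C → ∃ c₀ : ℝ, 0 < c₀ ∧
    ∀ ε ∈ Ioo 0 ε₁, ∀ x ∈ Ioo (-ℓ) ℓ, c₀ * ε ≤ |x - ξ| →
      |a ε x - stepFunction ξ am ap x| ≤ C ∧ ε * |deriv (a ε) x| ≤ C

/-- Hypothesis A3 for the family `a ε`, `0 < ε < ε₁`: the one-sided derivatives at `ξ` exist,
and `ε` times their absolute values have positive lower limits (possibly `+∞`) as `ε → 0+`. -/
structure HypA3 (ξ ε₁ : ℝ) (a : ℝ → ℝ → ℝ) : Prop where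
  left_differentiable : ∀ ε ∈ Ioo 0 ε₁, DifferentiableWithinAt ℝ (a ε) (Iic ξ) ξ
  right_differentiable : ∀ ε ∈ Ioo 0 ε₁, DifferentiableWithinAt ℝ (a ε) (Ici ξ) ξ
  left_liminf :
    0 < liminf (fun ε : ℝ => ((ε * |derivWithin (a ε) (Iic ξ) ξ| : ℝ) : EReal)) (𝓝[>] 0)
  right_liminf :
    0 < liminf (fun ε : ℝ => ((ε * |derivWithin (a ε) (Ici ξ) ξ| : ℝ) : EReal)) (𝓝[>] 0)

/-- `u` belongs to `H²(-ℓ, ℓ) ∩ H¹₀(-ℓ, ℓ)`, with first derivative `du` (absolutely continuous on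
`[-ℓ, ℓ]`) and weak second derivative `d2u ∈ L²(-ℓ, ℓ)`. -/
structure IsH2Dirichlet (ℓ : ℝ) (u du d2u : ℝ → ℂ) : Prop where
  memLp : MemLp d2u 2 (volume.restrict (Ioo (-ℓ) ℓ))
  du_eq : ∀ x ∈ Icc (-ℓ) ℓ, du x = du (-ℓ) + ∫ t in (-ℓ)..x, d2u t
  u_eq : ∀ x ∈ Icc (-ℓ) ℓ, u x = ∫ t in (-ℓ)..x, du t
  u_right : u ℓ = 0

/-- `u` is an eigenfunction, with eigenvalue `lam`, of the operator `u ↦ ε u'' - (a u)'` in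
`L²(-ℓ, ℓ)` with domain `H²(-ℓ, ℓ) ∩ H¹₀(-ℓ, ℓ)`. -/
def IsEigenfunction (ℓ ε : ℝ) (a : ℝ → ℝ) (lam : ℂ) (u : ℝ → ℂ) : Prop :=
  (∃ du d2u : ℝ → ℂ, IsH2Dirichlet ℓ u du d2u ∧
    ∀ᵐ x ∂(volume.restrict (Ioo (-ℓ) ℓ)),
      (ε : ℂ) * d2u x - deriv (fun y => (a y : ℂ) * u y) x = lam * u x) ∧
  ∃ x ∈ Icc (-ℓ) ℓ, u x ≠ 0

/-- `lam` is an eigenvalue of `u ↦ ε u'' - (a u)'` with Dirichlet conditions at `±ℓ`. -/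
def IsEigenvalue (ℓ ε : ℝ) (a : ℝ → ℝ) (lam : ℂ) : Prop :=
  ∃ u : ℝ → ℂ, IsEigenfunction ℓ ε a lam u

/-- The eigenfunctions for `lam` are multiples of each other on `[-ℓ, ℓ]`. -/
def IsSimple (ℓ ε : ℝ) (a : ℝ → ℝ) (lam : ℂ) : Prop :=
  ∀ u v : ℝ → ℂ, IsEigenfunction ℓ ε a lam u → IsEigenfunction ℓ ε a lam v →
    ∃ c : ℂ, ∀ x ∈ Icc (-ℓ) ℓ, v x = c * u x

/-- `lam₂` is the second eigenvalue: there is a larger eigenvalue `lam₁`, which is simple, and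
every other (complex) eigenvalue is real and at most `lam₂`. -/
def IsSecondEigenvalue (ℓ ε : ℝ) (a : ℝ → ℝ) (lam₂ : ℝ) : Prop :=
  IsEigenvalue ℓ ε a (lam₂ : ℂ) ∧
  ∃ lam₁ : ℝ, lam₂ < lam₁ ∧ IsEigenvalue ℓ ε a (lam₁ : ℂ) ∧ IsSimple ℓ ε a (lam₁ : ℂ) ∧
    ∀ ν : ℂ, IsEigenvalue ℓ ε a ν → ν = (lam₁ : ℂ) ∨ (ν.im = 0 ∧ ν.re ≤ lam₂)

end DiffusionTransport

end

/-! With `ρ' = (a / ε) ρ`, `v = u / ρ` and the flux `J = ε u' - a u`, the eigenvalue equation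
becomes the first-order system `v' = P J`, `J' = λ ρ v` with `P = 1 / (ε ρ)`, a regular
Sturm–Liouville problem. Its eigenvalues are `-k²`, where `k` runs through the positive parameters
for which the Prüfer angle `θ' = k (P cos² θ + ρ sin² θ)`, `θ = 0` at `-ℓ`, reaches a multiple of
`π` at `ℓ`.

The second eigenfunction vanishes at the interior point `z` where the angle is `π`, so the second
eigenvalue is a Dirichlet eigenvalue of both `[-ℓ, z]` and `[z, ℓ]`. One of these intervals lies on
one side of `ξ`. There the drift `a` points towards `ξ` and is bounded away from `0` outside a layer
of width `O(ε)`, and Picone's identity with an explicit solution of a Riccati inequality bounds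
every Dirichlet eigenvalue by `-C / ε`. -/

namespace DiffusionTransport

lemma hasDerivWithinAt_integral_Icc {E : Type*} [NormedAddCommGroup E] [NormedSpace ℝ E]
    [CompleteSpace E] {α β : ℝ} {f : ℝ → E} (hf : ContinuousOn f (Icc α β)) {x : ℝ}
    (hx : x ∈ Icc α β) :
    HasDerivWithinAt (fun y => ∫ t in α..y, f t) (f x) (Icc α β) x := by
  have : Fact (x ∈ Icc α β) := ⟨hx⟩
  refine intervalIntegral.integral_hasDerivWithinAt_right (t := Icc α β) ?_
    ⟨Icc α β, self_mem_nhdsWithin, hf.aestronglyMeasurable measurableSet_Icc⟩ (hf x hx)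
  exact (hf.mono (Icc_subset_Icc_right hx.2)).intervalIntegrable_of_Icc hx.1

lemma exists_pos_hasDerivWithinAt_eq_mul {α β : ℝ} {c : ℝ → ℝ} (hc : ContinuousOn c (Icc α β)) :
    ∃ r : ℝ → ℝ, (∀ x, 0 < r x) ∧
      ∀ x ∈ Icc α β, HasDerivWithinAt r (c x * r x) (Icc α β) x := by
  refine ⟨fun x => Real.exp (∫ t in α..x, c t), fun _ => Real.exp_pos _, fun x hx => ?_⟩
  rw [mul_comm]
  exact (hasDerivWithinAt_integral_Icc hc hx).exp

/-! ### The scaled Prüfer angle -/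

/-- The right-hand side `P cos² θ + ρ sin² θ` of the scaled Prüfer equation. -/
noncomputable def prueferField (P ρ : ℝ → ℝ) (x θ : ℝ) : ℝ :=
  P x * Real.cos θ ^ 2 + ρ x * Real.sin θ ^ 2

/-- The scaled Prüfer angle of the problem `(v' / P)' + k² ρ v = 0`, `v α = 0`, on `[α, β]`: up to
a positive factor `v = sin θ` and `v' / P = k cos θ`. With this scaling the parameter `k`
multiplies the whole field, so that `θ` is increasing in `k`. -/
structure IsPrueferAngle (α β : ℝ) (P ρ : ℝ → ℝ) (k : ℝ) (θ : ℝ → ℝ) : Prop where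
  left : θ α = 0
  hasDerivWithinAt : ∀ x ∈ Icc α β,
    HasDerivWithinAt θ (k * prueferField P ρ x (θ x)) (Icc α β) x

section PrueferAngle

variable {α β : ℝ} {P ρ : ℝ → ℝ}

lemma abs_prueferField_sub_le (x s t : ℝ) :
    |prueferField P ρ x s - prueferField P ρ x t| ≤ (|P x| + |ρ x|) * |s - t| := by
  have key : prueferField P ρ x s - prueferField P ρ x t =
      (ρ x - P x) * (Real.sin (s - t) * Real.sin (s + t)) := by
    have hs := Real.cos_sq' s
    have ht := Real.cos_sq' t
    rw [prueferField, prueferField, Real.sin_sub, Real.sin_add]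
    linear_combination (P x + (ρ x - P x) * Real.sin t ^ 2) * hs -
      (P x + (ρ x - P x) * Real.sin s ^ 2) * ht
  rw [key, abs_mul, abs_mul]
  gcongr ?_ * ?_
  · rw [add_comm]
    exact abs_sub _ _
  · calc |Real.sin (s - t)| * |Real.sin (s + t)| ≤ |s - t| * 1 := by
          gcongr ?_ * ?_
          exacts [Real.abs_sin_le_abs, Real.abs_sin_le_one _]
      _ = |s - t| := mul_one _

lemma le_prueferField {x c : ℝ} (hP : c ≤ P x) (hρ : c ≤ ρ x) (θ : ℝ) :
    c ≤ prueferField P ρ x θ := by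
  calc c = c * Real.cos θ ^ 2 + c * Real.sin θ ^ 2 := by
        rw [← mul_add, Real.cos_sq_add_sin_sq, mul_one]
    _ ≤ prueferField P ρ x θ := by
        rw [prueferField]
        gcongr

lemma abs_prueferField_le (x θ : ℝ) : |prueferField P ρ x θ| ≤ |P x| + |ρ x| := by
  rw [prueferField]
  refine (abs_add_le _ _).trans ?_
  rw [abs_mul, abs_mul, abs_sq, abs_sq]
  gcongr
  · exact mul_le_of_le_one_right (abs_nonneg _) (Real.cos_sq_le_one θ)
  · exact mul_le_of_le_one_right (abs_nonneg _) (Real.sin_sq_le_one θ)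

lemma prueferField_pos {x : ℝ} (hP : 0 < P x) (hρ : 0 < ρ x) (θ : ℝ) :
    0 < prueferField P ρ x θ :=
  (lt_min hP hρ).trans_le (le_prueferField (min_le_left _ _) (min_le_right _ _) θ)

lemma exists_abs_add_abs_le (hP : ContinuousOn P (Icc α β)) (hρ : ContinuousOn ρ (Icc α β)) :
    ∃ M : NNReal, ∀ x ∈ Icc α β, |P x| + |ρ x| ≤ M := by
  obtain ⟨M, hM⟩ := isCompact_Icc.exists_bound_of_continuousOn (hP.abs.add hρ.abs)
  exact ⟨M.toNNReal, fun x hx =>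
    (le_abs_self _).trans ((hM x hx).trans (Real.le_coe_toNNReal M))⟩

lemma exists_isPrueferAngle (hαβ : α ≤ β)
    (hP : ContinuousOn P (Icc α β)) (hρ : ContinuousOn ρ (Icc α β)) (k : ℝ) :
    ∃ θ, IsPrueferAngle α β P ρ k θ := by
  obtain ⟨M, hM⟩ := exists_abs_add_abs_le hP hρ
  have hpl : IsPicardLindelof (fun x θ => k * prueferField P ρ x θ)
      (⟨α, left_mem_Icc.2 hαβ⟩ : Icc α β) 0 (‖k‖₊ * M * (β - α).toNNReal) 0
      (‖k‖₊ * M) (‖k‖₊ * M) := by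
    refine ⟨fun x hx => ?_, fun θ _ => ?_, fun x hx θ _ => ?_, ?_⟩
    · refine LipschitzOnWith.of_dist_le_mul fun s _ t _ => ?_
      rw [Real.dist_eq, Real.dist_eq, ← mul_sub, abs_mul, NNReal.coe_mul, coe_nnnorm,
        Real.norm_eq_abs, mul_assoc]
      gcongr
      exact (abs_prueferField_sub_le x s t).trans (by gcongr; exact hM x hx)
    · unfold prueferField
      fun_prop
    · rw [norm_mul, NNReal.coe_mul, coe_nnnorm]
      gcongr
      exact (abs_prueferField_le x θ).trans (hM x hx)
    · simp [hαβ]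
  obtain ⟨θ, hθ0, hθ⟩ := hpl.exists_eq_forall_mem_Icc_hasDerivWithinAt₀
  exact ⟨θ, hθ0, hθ⟩

namespace IsPrueferAngle

variable {k k₁ k₂ : ℝ} {θ θ₁ θ₂ : ℝ → ℝ}

lemma continuousOn (h : IsPrueferAngle α β P ρ k θ) : ContinuousOn θ (Icc α β) :=
  fun x hx => (h.hasDerivWithinAt x hx).continuousWithinAt

lemma hasDerivWithinAt_Ici (h : IsPrueferAngle α β P ρ k θ) {x : ℝ} (hx : x ∈ Ico α β) :
    HasDerivWithinAt θ (k * prueferField P ρ x (θ x)) (Ici x) x :=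
  (h.hasDerivWithinAt x (Ico_subset_Icc_self hx)).mono_of_mem_nhdsWithin
    (Icc_mem_nhdsGE_of_mem hx)

lemma apply_le_apply (hP0 : ∀ x ∈ Icc α β, 0 < P x)
    (hρ0 : ∀ x ∈ Icc α β, 0 < ρ x) (h₁ : IsPrueferAngle α β P ρ k₁ θ₁)
    (h₂ : IsPrueferAngle α β P ρ k₂ θ₂) (hk : k₁ < k₂) {x : ℝ} (hx : x ∈ Icc α β) :
    θ₁ x ≤ θ₂ x := by
  refine image_le_of_deriv_right_lt_deriv_boundary' h₁.continuousOn
    (fun _ => h₁.hasDerivWithinAt_Ici) (by rw [h₁.left, h₂.left]) h₂.continuousOn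
    (fun _ => h₂.hasDerivWithinAt_Ici) (fun y hy heq => ?_) hx
  have hy' := Ico_subset_Icc_self hy
  rw [heq]
  exact mul_lt_mul_of_pos_right hk (prueferField_pos (hP0 y hy') (hρ0 y hy') _)

lemma right_lt_right (hαβ : α < β) (hP0 : ∀ x ∈ Icc α β, 0 < P x)
    (hρ0 : ∀ x ∈ Icc α β, 0 < ρ x) (h₁ : IsPrueferAngle α β P ρ k₁ θ₁)
    (h₂ : IsPrueferAngle α β P ρ k₂ θ₂) (hk : k₁ < k₂) : θ₁ β < θ₂ β := by
  have hβ := right_mem_Icc.2 hαβ.le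
  refine (apply_le_apply hP0 hρ0 h₁ h₂ hk hβ).lt_of_ne fun heq => ?_
  -- Otherwise `θ₂ - θ₁` would be nonnegative and reach `0` at `β` with a positive slope.
  have hd := (h₂.hasDerivWithinAt β hβ).sub (h₁.hasDerivWithinAt β hβ)
  rw [heq, ← sub_mul] at hd
  have : (𝓝[Icc α β \ {β}] β).NeBot := by
    rw [Icc_sdiff_right]
    exact right_nhdsWithin_Ico_neBot hαβ
  refine (le_of_tendsto (hasDerivWithinAt_iff_tendsto_slope.1 hd) ?_).not_gt
    (mul_pos (sub_pos.2 hk) (prueferField_pos (hP0 β hβ) (hρ0 β hβ) _))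
  filter_upwards [self_mem_nhdsWithin] with x hx
  rw [slope_def_field]
  refine div_nonpos_of_nonneg_of_nonpos ?_ (sub_nonpos.2 hx.1.2)
  simpa [heq] using apply_le_apply hP0 hρ0 h₁ h₂ hk hx.1

lemma strictMono_right (hαβ : α < β) (hP0 : ∀ x ∈ Icc α β, 0 < P x)
    (hρ0 : ∀ x ∈ Icc α β, 0 < ρ x) {θ : ℝ → ℝ → ℝ}
    (hθ : ∀ k, IsPrueferAngle α β P ρ k (θ k)) : StrictMono fun k => θ k β :=
  fun k₁ k₂ hk => right_lt_right hαβ hP0 hρ0 (hθ k₁) (hθ k₂) hk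

lemma right_eq_zero (hαβ : α ≤ β) (h : IsPrueferAngle α β P ρ 0 θ) : θ β = 0 := by
  refine (constant_of_has_deriv_right_zero h.continuousOn (fun x hx => ?_) β
    (right_mem_Icc.2 hαβ)).trans h.left
  simpa using h.hasDerivWithinAt_Ici hx

lemma mul_le_right (hαβ : α ≤ β) {c : ℝ} (hP : ∀ x ∈ Icc α β, c ≤ P x)
    (hρ : ∀ x ∈ Icc α β, c ≤ ρ x) (h : IsPrueferAngle α β P ρ k θ) (hk : 0 ≤ k) :
    k * c * (β - α) ≤ θ β := by
  have hd : ∀ x ∈ interior (Icc α β), HasDerivAt θ (k * prueferField P ρ x (θ x)) x :=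
    fun x hx => (h.hasDerivWithinAt x (interior_subset hx)).hasDerivAt
      (mem_interior_iff_mem_nhds.1 hx)
  have := (convex_Icc α β).mul_sub_le_image_sub_of_le_deriv (C := k * c) h.continuousOn
    (fun x hx => (hd x hx).differentiableAt.differentiableWithinAt)
    (fun x hx => by
      rw [(hd x hx).deriv]
      gcongr
      exact le_prueferField (hP x (interior_subset hx)) (hρ x (interior_subset hx)) _)
    α (left_mem_Icc.2 hαβ) β (right_mem_Icc.2 hαβ) hαβ
  rwa [h.left, sub_zero] at this

lemma continuous_right (hαβ : α ≤ β) (hP : ContinuousOn P (Icc α β))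
    (hρ : ContinuousOn ρ (Icc α β)) {θ : ℝ → ℝ → ℝ}
    (hθ : ∀ k, IsPrueferAngle α β P ρ k (θ k)) : Continuous fun k => θ k β := by
  obtain ⟨M, hM⟩ := exists_abs_add_abs_le hP hρ
  refine continuous_iff_continuousAt.2 fun k₀ => tendsto_iff_dist_tendsto_zero.2 ?_
  have hbound : ∀ k, dist (θ k β) (θ k₀ β) ≤
      gronwallBound 0 (‖k₀‖₊ * M) (|k - k₀| * M) (β - α) := by
    intro k
    have := dist_le_of_approx_trajectories_ODE_of_mem (K := ‖k₀‖₊ * M) (s := fun _ => univ)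
      (v := fun x y => k₀ * prueferField P ρ x y) (εf := |k - k₀| * M) (εg := 0) (δ := 0)
      (fun x hx => LipschitzOnWith.of_dist_le_mul fun s _ t _ => ?_) (hθ k).continuousOn
      (fun _ => (hθ k).hasDerivWithinAt_Ici) (fun x hx => ?_) (fun _ _ => mem_univ _)
      (hθ k₀).continuousOn (fun _ => (hθ k₀).hasDerivWithinAt_Ici) (fun x _ => (dist_self _).le)
      (fun _ _ => mem_univ _) (by rw [(hθ k).left, (hθ k₀).left, dist_self]) β
      (right_mem_Icc.2 hαβ)
    · simpa using this
    · rw [Real.dist_eq, Real.dist_eq, ← mul_sub, abs_mul, NNReal.coe_mul, coe_nnnorm,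
        Real.norm_eq_abs, mul_assoc]
      gcongr
      exact (abs_prueferField_sub_le x s t).trans
        (by gcongr; exact hM x (Ico_subset_Icc_self hx))
    · rw [Real.dist_eq, ← sub_mul, abs_mul]
      gcongr
      exact (abs_prueferField_le x _).trans (hM x (Ico_subset_Icc_self hx))
  have hlim : Tendsto (fun k => gronwallBound 0 (‖k₀‖₊ * M) (|k - k₀| * M) (β - α))
      (𝓝 k₀) (𝓝 0) := by
    have hc : Continuous fun k => gronwallBound 0 (‖k₀‖₊ * M) (|k - k₀| * M) (β - α) :=
      (gronwallBound_continuous_ε 0 _ (β - α)).comp (by fun_prop)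
    simpa [gronwallBound_ε0_δ0] using hc.tendsto k₀
  exact squeeze_zero (fun _ => dist_nonneg) hbound hlim

lemma exists_right_eq (hαβ : α < β) (hP : ContinuousOn P (Icc α β))
    (hρ : ContinuousOn ρ (Icc α β)) (hP0 : ∀ x ∈ Icc α β, 0 < P x)
    (hρ0 : ∀ x ∈ Icc α β, 0 < ρ x) {θ : ℝ → ℝ → ℝ}
    (hθ : ∀ k, IsPrueferAngle α β P ρ k (θ k)) {s : ℝ} (hs : 0 < s) :
    ∃ k > 0, θ k β = s := by
  have hne := nonempty_Icc.2 hαβ.le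
  obtain ⟨p, hp, hpmin⟩ := isCompact_Icc.exists_isMinOn hne hP
  obtain ⟨r, hr, hrmin⟩ := isCompact_Icc.exists_isMinOn hne hρ
  obtain ⟨c, hc, hcp, hcr⟩ : ∃ c > 0, c ≤ P p ∧ c ≤ ρ r :=
    ⟨min (P p) (ρ r), lt_min (hP0 p hp) (hρ0 r hr), min_le_left _ _, min_le_right _ _⟩
  have hpos : 0 < c * (β - α) := mul_pos hc (sub_pos.2 hαβ)
  have h0 : θ 0 β = 0 := (hθ 0).right_eq_zero hαβ.le
  have hK : s ≤ θ (s / (c * (β - α))) β := by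
    have := (hθ (s / (c * (β - α)))).mul_le_right hαβ.le (fun x hx => hcp.trans (hpmin hx))
      (fun x hx => hcr.trans (hrmin hx)) (div_pos hs hpos).le
    rwa [mul_assoc, div_mul_cancel₀ _ hpos.ne'] at this
  obtain ⟨k, hk⟩ := mem_range_of_exists_le_of_exists_ge (continuous_right hαβ.le hP hρ hθ)
    ⟨0, h0.trans_le hs.le⟩ ⟨_, hK⟩
  refine ⟨k, (strictMono_right hαβ hP0 hρ0 hθ).lt_iff_lt.1 ?_, hk⟩
  exact h0.trans_lt (hs.trans_eq hk.symm)

end IsPrueferAngle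

end PrueferAngle

/-! ### The Dirichlet problem -/

/-- `(v, J)` solves the first-order form `v' = P J`, `J' = λ ρ v` of the equation
`(v' / P)' = λ ρ v` on `[α, β]`. -/
structure IsSolution (α β : ℝ) (P ρ : ℝ → ℝ) (lam : ℂ) (v J : ℝ → ℂ) : Prop where
  hasDerivWithinAt_fst : ∀ x ∈ Icc α β, HasDerivWithinAt v (P x * J x) (Icc α β) x
  hasDerivWithinAt_snd : ∀ x ∈ Icc α β, HasDerivWithinAt J (lam * ρ x * v x) (Icc α β) x

/-- A nontrivial solution of the first-order system vanishing at both endpoints. -/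
structure IsDirichletSolution (α β : ℝ) (P ρ : ℝ → ℝ) (lam : ℂ) (v J : ℝ → ℂ) : Prop
    extends IsSolution α β P ρ lam v J where
  left : v α = 0
  right : v β = 0
  ne_zero : ∃ x ∈ Icc α β, v x ≠ 0

/-- `lam` is an eigenvalue of the Dirichlet problem `(v' / P)' = λ ρ v` on `[α, β]`. -/
def IsDirichletEigenvalue (α β : ℝ) (P ρ : ℝ → ℝ) (lam : ℂ) : Prop :=
  ∃ v J : ℝ → ℂ, IsDirichletSolution α β P ρ lam v J

section DirichletProblem

variable {α β : ℝ} {P ρ : ℝ → ℝ} {lam : ℂ} {v J w K : ℝ → ℂ}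

namespace IsSolution

lemma continuousOn_fst (h : IsSolution α β P ρ lam v J) : ContinuousOn v (Icc α β) :=
  fun x hx => (h.hasDerivWithinAt_fst x hx).continuousWithinAt

lemma continuousOn_snd (h : IsSolution α β P ρ lam v J) : ContinuousOn J (Icc α β) :=
  fun x hx => (h.hasDerivWithinAt_snd x hx).continuousWithinAt

lemma mono {s t : ℝ} (h : IsSolution α β P ρ lam v J) (hst : Icc s t ⊆ Icc α β) :
    IsSolution s t P ρ lam v J :=
  ⟨fun x hx => (h.hasDerivWithinAt_fst x (hst hx)).mono hst,
    fun x hx => (h.hasDerivWithinAt_snd x (hst hx)).mono hst⟩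

lemma sub_const_mul (h : IsSolution α β P ρ lam v J) (h' : IsSolution α β P ρ lam w K) (c : ℂ) :
    IsSolution α β P ρ lam (fun x => w x - c * v x) (fun x => K x - c * J x) where
  hasDerivWithinAt_fst x hx := by
    convert! (h'.hasDerivWithinAt_fst x hx).fun_sub
      ((h.hasDerivWithinAt_fst x hx).const_mul c) using 1
    ring
  hasDerivWithinAt_snd x hx := by
    convert! (h'.hasDerivWithinAt_snd x hx).fun_sub
      ((h.hasDerivWithinAt_snd x hx).const_mul c) using 1
    ring

lemma eq_zero (hP : ContinuousOn P (Icc α β)) (hρ : ContinuousOn ρ (Icc α β))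
    (h : IsSolution α β P ρ lam v J) (hv : v α = 0) (hJ : J α = 0) :
    ∀ x ∈ Icc α β, v x = 0 := by
  obtain ⟨A, hA⟩ := isCompact_Icc.exists_bound_of_continuousOn hP
  obtain ⟨B, hB⟩ := isCompact_Icc.exists_bound_of_continuousOn hρ
  have hzero := eq_zero_of_abs_deriv_le_mul_abs_self_of_eq_zero_right (a := α) (b := β)
    (f := fun x => (v x, J x)) (f' := fun x => (P x * J x, lam * ρ x * v x))
    (K := max A (‖lam‖ * B)) (h.continuousOn_fst.prodMk h.continuousOn_snd)
    (fun x hx => ((h.hasDerivWithinAt_fst x (Ico_subset_Icc_self hx)).prodMk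
      (h.hasDerivWithinAt_snd x (Ico_subset_Icc_self hx))).mono_of_mem_nhdsWithin
        (Icc_mem_nhdsGE_of_mem hx))
    (by rw [hv, hJ]; rfl) fun x hx => ?_
  · exact fun x hx => congrArg Prod.fst (hzero x hx)
  have hx' := Ico_subset_Icc_self hx
  refine norm_prod_le_iff.2 ⟨?_, ?_⟩
  · have hK := (hA x hx').trans (le_max_left A (‖lam‖ * B))
    rw [norm_mul, Complex.norm_real]
    exact mul_le_mul hK (norm_snd_le (v x, J x)) (norm_nonneg _) ((norm_nonneg _).trans hK)
  · have hK := (mul_le_mul_of_nonneg_left (hB x hx') (norm_nonneg lam)).trans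
      (le_max_right A (‖lam‖ * B))
    rw [norm_mul, norm_mul, Complex.norm_real]
    exact mul_le_mul hK (norm_fst_le (v x, J x)) (norm_nonneg _) (le_trans (by positivity) hK)

/-- Picone's identity: integrated along a solution `g` of `g' + P g² ≤ -κ ρ` it bounds `Re λ` by
`-κ`, and for `g = 0` it is the energy identity. -/
lemma hasDerivWithinAt_star_mul_sub (h : IsSolution α β P ρ lam v J) {g : ℝ → ℝ} {g' x : ℝ}
    (hx : x ∈ Icc α β) (hg : HasDerivWithinAt g g' (Icc α β) x) :
    HasDerivWithinAt (fun y => star (v y) * (J y - g y * v y))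
      (((P x * ‖J x - g x * v x‖ ^ 2 : ℝ) : ℂ) + lam * ((ρ x * ‖v x‖ ^ 2 : ℝ) : ℂ) -
        (((g' + P x * g x ^ 2) * ‖v x‖ ^ 2 : ℝ) : ℂ)) (Icc α β) x := by
  have hv := h.hasDerivWithinAt_fst x hx
  convert! hv.star.fun_mul ((h.hasDerivWithinAt_snd x hx).fun_sub (hg.ofReal_comp.fun_mul hv))
    using 1
  push_cast
  rw [← Complex.conj_mul', ← Complex.conj_mul', star_mul', Complex.star_def, Complex.conj_ofReal,
    map_sub, map_mul, Complex.conj_ofReal]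
  ring

end IsSolution

lemma integral_mul_norm_sq_pos (hαβ : α < β) (hρ : ContinuousOn ρ (Icc α β))
    (hρ0 : ∀ x ∈ Icc α β, 0 < ρ x) (hv : ContinuousOn v (Icc α β))
    (hne : ∃ x ∈ Icc α β, v x ≠ 0) : 0 < ∫ x in α..β, ρ x * ‖v x‖ ^ 2 := by
  obtain ⟨x, hx, hvx⟩ := hne
  exact intervalIntegral.integral_pos hαβ (hρ.mul (hv.norm.pow 2))
    (fun y hy => mul_nonneg (hρ0 y (Ioc_subset_Icc_self hy)).le (sq_nonneg _))
    ⟨x, hx, mul_pos (hρ0 x hx) (pow_pos (norm_pos_iff.2 hvx) 2)⟩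

namespace IsDirichletSolution

lemma lt (h : IsDirichletSolution α β P ρ lam v J) : α < β := by
  obtain ⟨x, hx, hvx⟩ := h.ne_zero
  refine (hx.1.lt_of_ne ?_).trans_le hx.2
  rintro rfl
  exact hvx h.left

lemma snd_left_ne_zero (hP : ContinuousOn P (Icc α β)) (hρ : ContinuousOn ρ (Icc α β))
    (h : IsDirichletSolution α β P ρ lam v J) : J α ≠ 0 := fun hJ =>
  let ⟨x, hx, hvx⟩ := h.ne_zero
  hvx (h.eq_zero hP hρ h.left hJ x hx)

lemma exists_eq_const_mul (hP : ContinuousOn P (Icc α β)) (hρ : ContinuousOn ρ (Icc α β))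
    (h : IsDirichletSolution α β P ρ lam v J) (h' : IsSolution α β P ρ lam w K) (hw : w α = 0) :
    ∃ c : ℂ, ∀ x ∈ Icc α β, w x = c * v x := by
  refine ⟨K α / J α, fun x hx => sub_eq_zero.1 ?_⟩
  refine (h.toIsSolution.sub_const_mul h' (K α / J α)).eq_zero hP hρ ?_ ?_ x hx
  · rw [hw, h.left, mul_zero, sub_zero]
  · rw [div_mul_cancel₀ _ (h.snd_left_ne_zero hP hρ), sub_self]

lemma mul_integral_eq (hP : ContinuousOn P (Icc α β)) (hρ : ContinuousOn ρ (Icc α β))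
    (h : IsDirichletSolution α β P ρ lam v J) :
    lam * ((∫ x in α..β, ρ x * ‖v x‖ ^ 2 : ℝ) : ℂ) =
      -((∫ x in α..β, P x * ‖J x‖ ^ 2 : ℝ) : ℂ) := by
  have hderiv x (hx : x ∈ Icc α β) : HasDerivWithinAt (fun y => star (v y) * J y)
      (((P x * ‖J x‖ ^ 2 : ℝ) : ℂ) + lam * ((ρ x * ‖v x‖ ^ 2 : ℝ) : ℂ)) (Icc α β) x := by
    simpa using h.hasDerivWithinAt_star_mul_sub hx (hasDerivWithinAt_const x (Icc α β) (0 : ℝ))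
  have hI₁ : IntervalIntegrable (fun x => ((P x * ‖J x‖ ^ 2 : ℝ) : ℂ)) volume α β :=
    (Complex.continuous_ofReal.comp_continuousOn
      (hP.mul (h.continuousOn_snd.norm.pow 2))).intervalIntegrable_of_Icc h.lt.le
  have hI₂ : IntervalIntegrable (fun x => lam * ((ρ x * ‖v x‖ ^ 2 : ℝ) : ℂ)) volume α β :=
    (continuousOn_const.mul (Complex.continuous_ofReal.comp_continuousOn
      (hρ.mul (h.continuousOn_fst.norm.pow 2)))).intervalIntegrable_of_Icc h.lt.le
  have hftc := intervalIntegral.integral_eq_sub_of_hasDerivAt_of_le h.lt.le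
    (fun x hx => (hderiv x hx).continuousWithinAt)
    (fun x hx => (hderiv x (Ioo_subset_Icc_self hx)).hasDerivAt (Icc_mem_nhds hx.1 hx.2))
    (hI₁.add hI₂)
  rw [intervalIntegral.integral_add hI₁ hI₂, intervalIntegral.integral_const_mul,
    intervalIntegral.integral_ofReal, intervalIntegral.integral_ofReal, h.left, h.right, star_zero,
    zero_mul, zero_mul, sub_zero] at hftc
  exact eq_neg_of_add_eq_zero_right hftc

lemma exists_eq_neg_sq (hP : ContinuousOn P (Icc α β)) (hρ : ContinuousOn ρ (Icc α β))
    (hP0 : ∀ x ∈ Icc α β, 0 < P x) (hρ0 : ∀ x ∈ Icc α β, 0 < ρ x)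
    (h : IsDirichletSolution α β P ρ lam v J) : ∃ k : ℝ, 0 < k ∧ lam = ((-k ^ 2 : ℝ) : ℂ) := by
  have hv := integral_mul_norm_sq_pos h.lt hρ hρ0 h.continuousOn_fst h.ne_zero
  have hJ := integral_mul_norm_sq_pos h.lt hP hP0 h.continuousOn_snd
    ⟨α, left_mem_Icc.2 h.lt.le, h.snd_left_ne_zero hP hρ⟩
  refine ⟨√((∫ x in α..β, P x * ‖J x‖ ^ 2) / ∫ x in α..β, ρ x * ‖v x‖ ^ 2),
    Real.sqrt_pos.2 (div_pos hJ hv), ?_⟩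
  rw [Real.sq_sqrt (div_pos hJ hv).le, ← neg_div, Complex.ofReal_div, Complex.ofReal_neg,
    ← h.mul_integral_eq hP hρ, mul_div_cancel_right₀ _ (Complex.ofReal_ne_zero.2 hv.ne')]

lemma re_le_of_riccati (hρ : ContinuousOn ρ (Icc α β)) (hP0 : ∀ x ∈ Ioo α β, 0 ≤ P x)
    (hρ0 : ∀ x ∈ Icc α β, 0 < ρ x) (h : IsDirichletSolution α β P ρ lam v J) {g g' : ℝ → ℝ} {κ : ℝ}
    (hg : ∀ x ∈ Icc α β, HasDerivWithinAt g (g' x) (Icc α β) x)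
    (hric : ∀ x ∈ Ioo α β, g' x + P x * g x ^ 2 ≤ -κ * ρ x) : lam.re ≤ -κ := by
  have hderiv x (hx : x ∈ Icc α β) := Complex.reCLM.hasFDerivAt.comp_hasDerivWithinAt x
    (h.hasDerivWithinAt_star_mul_sub hx (hg x hx))
  have hint : (∫ x in α..β, (lam.re + κ) * (ρ x * ‖v x‖ ^ 2)) ≤ 0 := by
    refine (intervalIntegral.integral_le_sub_of_hasDeriv_right_of_le
      (φ := fun x => (lam.re + κ) * (ρ x * ‖v x‖ ^ 2)) h.lt.le
      (fun x hx => (hderiv x hx).continuousWithinAt)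
      (fun x hx => ((hderiv x (Ioo_subset_Icc_self hx)).hasDerivAt
        (Icc_mem_nhds hx.1 hx.2)).hasDerivWithinAt)
      (continuousOn_const.mul (hρ.mul (h.continuousOn_fst.norm.pow 2))).integrableOn_Icc
      fun x hx => ?_).trans_eq (by simp [h.left, h.right])
    have hsq := mul_nonneg (hP0 x hx) (sq_nonneg ‖J x - g x * v x‖)
    have hκ := mul_le_mul_of_nonneg_right (hric x hx) (sq_nonneg ‖v x‖)
    rw [Complex.reCLM_apply, Complex.sub_re, Complex.add_re, Complex.re_mul_ofReal,
      Complex.ofReal_re, Complex.ofReal_re]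
    linarith
  rw [intervalIntegral.integral_const_mul] at hint
  have hpos := integral_mul_norm_sq_pos h.lt hρ hρ0 h.continuousOn_fst h.ne_zero
  linarith [nonpos_of_mul_nonpos_left hint hpos]

end IsDirichletSolution

namespace IsPrueferAngle

variable {k : ℝ} {θ : ℝ → ℝ}

lemma exists_isSolution (hP : ContinuousOn P (Icc α β)) (hρ : ContinuousOn ρ (Icc α β))
    (h : IsPrueferAngle α β P ρ k θ) :
    ∃ r : ℝ → ℝ, (∀ x, 0 < r x) ∧ IsSolution α β P ρ ((-k ^ 2 : ℝ) : ℂ)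
      (fun x => ((r x * Real.sin (θ x) : ℝ) : ℂ))
      (fun x => ((k * (r x * Real.cos (θ x)) : ℝ) : ℂ)) := by
  have hθ := h.continuousOn
  have hc : ContinuousOn (fun x => k * ((P x - ρ x) * (Real.sin (θ x) * Real.cos (θ x))))
      (Icc α β) := by fun_prop
  obtain ⟨r, hr0, hr⟩ := exists_pos_hasDerivWithinAt_eq_mul hc
  refine ⟨r, hr0, fun x hx => ?_, fun x hx => ?_⟩
  · convert! ((hr x hx).fun_mul (h.hasDerivWithinAt x hx).sin).ofReal_comp using 1
    rw [← Complex.ofReal_mul]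
    congr 1
    rw [prueferField]
    linear_combination (-k * P x * Real.cos (θ x) * r x) * Real.sin_sq_add_cos_sq (θ x)
  · convert! (((hr x hx).fun_mul (h.hasDerivWithinAt x hx).cos).const_mul k).ofReal_comp using 1
    rw [← Complex.ofReal_mul, ← Complex.ofReal_mul]
    congr 1
    rw [prueferField]
    linear_combination (k ^ 2 * ρ x * Real.sin (θ x) * r x) * Real.sin_sq_add_cos_sq (θ x)

lemma isDirichletEigenvalue (hP : ContinuousOn P (Icc α β)) (hρ : ContinuousOn ρ (Icc α β))
    (h : IsPrueferAngle α β P ρ k θ) {s t : ℝ} (hst : s ≤ t) (hs : α ≤ s) (ht : t ≤ β)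
    (hθs : Real.sin (θ s) = 0) (hθt : Real.sin (θ t) = 0) (hθ : θ s + Real.pi ≤ θ t) :
    IsDirichletEigenvalue s t P ρ ((-k ^ 2 : ℝ) : ℂ) := by
  have hsub : Icc s t ⊆ Icc α β := Icc_subset_Icc hs ht
  obtain ⟨r, hr, hsol⟩ := h.exists_isSolution hP hρ
  obtain ⟨y, hy, hθy⟩ := intermediate_value_Icc hst (h.continuousOn.mono hsub)
    (show θ s + Real.pi / 2 ∈ Icc (θ s) (θ t) by constructor <;> linarith [Real.pi_pos])
  refine ⟨_, _, hsol.mono hsub, by simp [hθs], by simp [hθt], y, hy, ?_⟩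
  have hcos : Real.cos (θ s) ≠ 0 := fun h0 => by
    simpa [hθs, h0] using Real.sin_sq_add_cos_sq (θ s)
  rw [Complex.ofReal_ne_zero, hθy, Real.sin_add_pi_div_two]
  exact mul_ne_zero (hr y).ne' hcos

lemma right_eq_pi_or_two_pi_le (hP : ContinuousOn P (Icc α β)) (hρ : ContinuousOn ρ (Icc α β))
    (h : IsPrueferAngle α β P ρ k θ) (hθ : 0 < θ β)
    (hk : IsDirichletEigenvalue α β P ρ ((-k ^ 2 : ℝ) : ℂ)) :
    θ β = Real.pi ∨ 2 * Real.pi ≤ θ β := by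
  obtain ⟨v, J, hv⟩ := hk
  obtain ⟨r, hr, hsol⟩ := h.exists_isSolution hP hρ
  obtain ⟨c, hc⟩ := hv.exists_eq_const_mul hP hρ hsol (by simp [h.left])
  have hsin : Real.sin (θ β) = 0 := by
    have := hc β (right_mem_Icc.2 hv.lt.le)
    rw [hv.right, mul_zero, Complex.ofReal_eq_zero] at this
    exact (mul_eq_zero.1 this).resolve_left (hr β).ne'
  obtain ⟨n, hn⟩ := Real.sin_eq_zero_iff.1 hsin
  rw [← hn] at hθ ⊢
  have hn0 : 0 < n := by exact_mod_cast pos_of_mul_pos_left hθ Real.pi_pos.le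
  obtain rfl | hn2 : n = 1 ∨ 2 ≤ n := by lia
  · exact .inl (by simp)
  · exact .inr (by gcongr; exact_mod_cast hn2)

end IsPrueferAngle

lemma exists_second_isDirichletEigenvalue (hαβ : α < β) (hP : ContinuousOn P (Icc α β))
    (hρ : ContinuousOn ρ (Icc α β)) (hP0 : ∀ x ∈ Icc α β, 0 < P x)
    (hρ0 : ∀ x ∈ Icc α β, 0 < ρ x) :
    ∃ lam₁ lam₂ : ℝ, lam₂ < lam₁ ∧ IsDirichletEigenvalue α β P ρ lam₁ ∧
      IsDirichletEigenvalue α β P ρ lam₂ ∧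
      (∀ ν : ℂ, IsDirichletEigenvalue α β P ρ ν → ν = lam₁ ∨ (ν.im = 0 ∧ ν.re ≤ lam₂)) ∧
      ∃ z ∈ Icc α β, IsDirichletEigenvalue α z P ρ lam₂ ∧ IsDirichletEigenvalue z β P ρ lam₂ := by
  have hπ := Real.pi_pos
  choose θ hθ using exists_isPrueferAngle hαβ.le hP hρ
  have hmono := IsPrueferAngle.strictMono_right hαβ hP0 hρ0 hθ
  obtain ⟨k₁, hk₁, h₁⟩ := IsPrueferAngle.exists_right_eq hαβ hP hρ hP0 hρ0 hθ hπ
  obtain ⟨k₂, hk₂, h₂⟩ := IsPrueferAngle.exists_right_eq hαβ hP hρ hP0 hρ0 hθ Real.two_pi_pos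
  obtain ⟨z, hz, hθz⟩ := intermediate_value_Icc hαβ.le (hθ k₂).continuousOn
    (show Real.pi ∈ Icc (θ k₂ α) (θ k₂ β) by
      rw [(hθ k₂).left, h₂]; constructor <;> linarith)
  have hk : k₁ < k₂ := hmono.lt_iff_lt.1 (by simp only [h₁, h₂]; linarith)
  refine ⟨-k₁ ^ 2, -k₂ ^ 2, by gcongr, ?_, ?_, ?_, z, hz, ?_, ?_⟩
  · exact (hθ k₁).isDirichletEigenvalue hP hρ hαβ.le le_rfl le_rfl (by simp [(hθ k₁).left])
      (by simp [h₁]) (by simp [(hθ k₁).left, h₁])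
  · exact (hθ k₂).isDirichletEigenvalue hP hρ hαβ.le le_rfl le_rfl (by simp [(hθ k₂).left])
      (by simp [h₂]) (by rw [(hθ k₂).left, h₂]; linarith)
  · rintro ν ⟨v, J, hν⟩
    obtain ⟨k, hk0, rfl⟩ := hν.exists_eq_neg_sq hP hρ hP0 hρ0
    have hpos : 0 < θ k β := ((hθ 0).right_eq_zero hαβ.le).symm.trans_lt (hmono hk0)
    rcases (hθ k).right_eq_pi_or_two_pi_le hP hρ hpos ⟨v, J, hν⟩ with hπk | hπk
    · rw [hmono.injective (hπk.trans h₁.symm)]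
      exact .inl rfl
    · have hle : k₂ ≤ k := hmono.le_iff_le.1 (h₂.trans_le hπk)
      exact .inr ⟨Complex.ofReal_im _, by rw [Complex.ofReal_re]; gcongr⟩
  · exact (hθ k₂).isDirichletEigenvalue hP hρ hz.1 le_rfl hz.2 (by simp [(hθ k₂).left])
      (by simp [hθz]) (by simp [(hθ k₂).left, hθz])
  · exact (hθ k₂).isDirichletEigenvalue hP hρ hz.2 hz.1 le_rfl (by simp [hθz])
      (by simp [h₂]) (by rw [hθz, h₂]; linarith)

end DirichletProblem

/-! ### Drift towards a point -/

lemma drift_riccati_le {η E t : ℝ} (hη : 0 ≤ η) (hE0 : 0 ≤ E) (hE1 : E ≤ 1) (ht : 0 ≤ t)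
    (h : η ≤ E ∨ η ≤ t) :
    -(t * (η / 8 * (1 + E))) - η / 8 * E + (η / 8 * (1 + E)) ^ 2 ≤ -(η ^ 2 / 16) := by
  rcases h with h | h
  · nlinarith [mul_nonneg ht (mul_nonneg hη hE0), mul_nonneg ht hη, mul_le_mul_of_nonneg_left h hη,
      mul_nonneg (sq_nonneg η) (mul_nonneg (sub_nonneg.2 hE1) (add_nonneg hE0 zero_le_three))]
  · nlinarith [mul_le_mul_of_nonneg_right h (mul_nonneg hη (add_nonneg zero_le_one hE0)),
      mul_nonneg hη hE0, mul_nonneg (sq_nonneg η) (mul_nonneg (sub_nonneg.2 hE1) hE0),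
      mul_nonneg (sq_nonneg η) hE0]

/-- In the comparison function `-(η / 8) σ ρ (1 + E)`, `E = exp (σ (x - ξ) / ε)`, the constant
exploits the drift where it is at least `η`, and `E` replaces it in the layer where it may be
small. -/
lemma IsDirichletSolution.re_le_of_drift {α β ξ ε η σ : ℝ} {a ρ : ℝ → ℝ} {lam : ℂ} {v J : ℝ → ℂ}
    (hε : 0 < ε) (hη : 0 ≤ η) (hσ : σ ^ 2 = 1) (hρ0 : ∀ x, 0 < ρ x)
    (hρ : ∀ x ∈ Icc α β, HasDerivWithinAt ρ (a x / ε * ρ x) (Icc α β) x)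
    (hside : ∀ x ∈ Ioo α β, σ * (x - ξ) ≤ 0) (hdrift : ∀ x ∈ Ioo α β, 0 ≤ σ * a x)
    (hlarge : ∀ x ∈ Ioo α β, η ≤ Real.exp (σ * (x - ξ) / ε) ∨ η ≤ σ * a x)
    (h : IsDirichletSolution α β (fun x => (ε * ρ x)⁻¹) ρ lam v J) :
    lam.re ≤ -(η ^ 2 / 16 / ε) := by
  have hE x : HasDerivWithinAt (fun y => Real.exp (σ * (y - ξ) / ε))
      (Real.exp (σ * (x - ξ) / ε) * (σ / ε)) (Icc α β) x := by
    simpa using ((((hasDerivAt_id x).sub_const ξ).const_mul σ).div_const ε).exp.hasDerivWithinAt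
  refine h.re_le_of_riccati (fun x hx => (hρ x hx).continuousWithinAt)
    (fun x _ => (inv_pos.2 (mul_pos hε (hρ0 x))).le) (fun x _ => hρ0 x)
    (fun x hx => ((hρ x hx).fun_mul ((hE x).const_add 1)).const_mul (-(η / 8 * σ)))
    fun x hx => ?_
  set E := Real.exp (σ * (x - ξ) / ε)
  have hric := drift_riccati_le hη (Real.exp_pos _).le
    (Real.exp_le_one_iff.2 (div_nonpos_of_nonpos_of_nonneg (hside x hx) hε.le))
    (hdrift x hx) (hlarge x hx)
  have hρx := (hρ0 x).ne'
  calc _ = ρ x / ε * (-(σ * a x * (η / 8 * (1 + E))) - η / 8 * E + (η / 8 * (1 + E)) ^ 2) := by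
        field_simp
        linear_combination (η ^ 2 * (1 + E) ^ 2 - 8 * η * E) * hσ
    _ ≤ ρ x / ε * -(η ^ 2 / 16) :=
        mul_le_mul_of_nonneg_left hric (div_pos (hρ0 x) hε).le
    _ = -(η ^ 2 / 16 / ε) * ρ x := by ring

lemma IsDirichletEigenvalue.re_le_of_one_side {α β ξ ε m c σ : ℝ} {a ρ : ℝ → ℝ} {lam : ℂ}
    (hε : 0 < ε) (hm : 0 ≤ m) (hσ : |σ| = 1) (hρ0 : ∀ x, 0 < ρ x)
    (hρ : ∀ x ∈ Icc α β, HasDerivWithinAt ρ (a x / ε * ρ x) (Icc α β) x)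
    (hside : ∀ x ∈ Ioo α β, σ * (x - ξ) < 0) (hsign : ∀ x ∈ Ioo α β, (x - ξ) * a x ≤ 0)
    (hfar : ∀ x ∈ Ioo α β, c * ε ≤ |x - ξ| → m ≤ |a x|)
    (h : IsDirichletEigenvalue α β (fun x => (ε * ρ x)⁻¹) ρ lam) :
    lam.re ≤ -(min (Real.exp (-c)) m ^ 2 / 16 / ε) := by
  obtain ⟨v, J, hv⟩ := h
  have hσ2 : σ ^ 2 = 1 := by rw [← sq_abs, hσ, one_pow]
  have hdrift : ∀ x ∈ Ioo α β, 0 ≤ σ * a x := fun x hx => by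
    refine nonneg_of_mul_nonpos_right ?_ (hside x hx)
    calc σ * (x - ξ) * (σ * a x) = σ ^ 2 * ((x - ξ) * a x) := by ring
      _ ≤ 0 := by rw [hσ2, one_mul]; exact hsign x hx
  refine hv.re_le_of_drift hε (le_min (Real.exp_pos _).le hm) hσ2 hρ0 hρ
    (fun x hx => (hside x hx).le) hdrift fun x hx => ?_
  have hdist : |x - ξ| = -(σ * (x - ξ)) := by
    rw [← abs_of_neg (hside x hx), abs_mul, hσ, one_mul]
  rcases le_total (c * ε) |x - ξ| with hcx | hcx
  · right
    calc min (Real.exp (-c)) m ≤ m := min_le_right _ _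
      _ ≤ |a x| := hfar x hx hcx
      _ = σ * a x := by rw [← abs_of_nonneg (hdrift x hx), abs_mul, hσ, one_mul]
  · refine Or.inl ((min_le_left _ _).trans (Real.exp_le_exp.2 ?_))
    rw [le_div_iff₀ hε]
    linarith

/-! ### Eigenvalues of the operator -/

lemma integral_eq_sub_of_deriv_ae_eq {E : Type*} [NormedAddCommGroup E] [NormedSpace ℝ E]
    [CompleteSpace E] {α β : ℝ} {F g : ℝ → E} (hF : ContinuousOn F (Icc α β))
    (hd : {x ∈ Ioo α β | ¬ DifferentiableAt ℝ F x}.Countable)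
    (hFg : deriv F =ᵐ[volume.restrict (Ioo α β)] g) (hg : IntegrableOn g (Icc α β))
    {x : ℝ} (hx : x ∈ Icc α β) : ∫ t in α..x, g t = F x - F α := by
  rw [restrict_Ioo_eq_restrict_Icc] at hFg
  have hsub : Icc α x ⊆ Icc α β := Icc_subset_Icc_right hx.2
  have hint : IntegrableOn (deriv F) (Icc α x) := IntegrableOn.mono_set (hg.congr hFg.symm) hsub
  calc ∫ t in α..x, g t = ∫ t in α..x, deriv F t := by
        refine intervalIntegral.integral_congr_ae_restrict ?_
        rw [uIoc_of_le hx.1]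
        exact ae_restrict_of_ae_restrict_of_subset (Ioc_subset_Icc_self.trans hsub) hFg.symm
    _ = F x - F α := by
        refine integral_eq_of_hasDerivAt_off_countable_of_le F (deriv F) hx.1 hd (hF.mono hsub)
          (fun y hy => ?_) ((intervalIntegrable_iff_integrableOn_Icc_of_le hx.1).2 hint)
        have hy' : y ∈ Ioo α β := ⟨hy.1.1, hy.1.2.trans_le hx.2⟩
        exact (not_not.1 fun h => hy.2 ⟨hy', h⟩ : DifferentiableAt ℝ F y).hasDerivAt

lemma memLp_Ioo_of_continuousOn {E : Type*} [NormedAddCommGroup E] {α β : ℝ} {f : ℝ → E}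
    (p : ENNReal) (hf : ContinuousOn f (Icc α β)) : MemLp f p (volume.restrict (Ioo α β)) := by
  obtain ⟨M, hM⟩ := isCompact_Icc.exists_bound_of_continuousOn hf
  refine MemLp.of_bound ((hf.mono Ioo_subset_Icc_self).aestronglyMeasurable measurableSet_Ioo) M ?_
  filter_upwards [ae_restrict_mem measurableSet_Ioo] with x hx
  exact hM x (Ioo_subset_Icc_self hx)

/-- Coefficients in `H¹(-ℓ, ℓ)`, for which `u ↦ ε u'' - (a u)'` maps `H²(-ℓ, ℓ)` into
`L²(-ℓ, ℓ)`. As `deriv a` is the pointwise derivative, `a` is required to be continuous on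
`[-ℓ, ℓ]` and differentiable outside a countable set, so that it is a primitive of `deriv a`. -/
structure IsH1Coefficient (ℓ : ℝ) (a : ℝ → ℝ) : Prop where
  continuousOn : ContinuousOn a (Icc (-ℓ) ℓ)
  countable_not_differentiableAt : {x ∈ Ioo (-ℓ) ℓ | ¬ DifferentiableAt ℝ a x}.Countable
  memLp_deriv : MemLp (deriv a) 2 (volume.restrict (Ioo (-ℓ) ℓ))

section Operator

variable {ℓ ε : ℝ} {a ρ : ℝ → ℝ} {lam : ℂ} {u du d2u v J : ℝ → ℂ}

namespace IsH2Dirichlet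

lemma continuousOn_du (hℓ : -ℓ ≤ ℓ) (h : IsH2Dirichlet ℓ u du d2u) :
    ContinuousOn du (Icc (-ℓ) ℓ) := by
  have hint : IntegrableOn d2u (uIcc (-ℓ) ℓ) := by
    rw [uIcc_of_le hℓ, integrableOn_Icc_iff_integrableOn_Ioo]
    exact h.memLp.integrable one_le_two
  have hprim := intervalIntegral.continuousOn_primitive_interval hint
  rw [uIcc_of_le hℓ] at hprim
  exact (continuousOn_const.add hprim).congr h.du_eq

lemma hasDerivWithinAt (hℓ : -ℓ ≤ ℓ) (h : IsH2Dirichlet ℓ u du d2u) {x : ℝ}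
    (hx : x ∈ Icc (-ℓ) ℓ) : HasDerivWithinAt u (du x) (Icc (-ℓ) ℓ) x :=
  (hasDerivWithinAt_integral_Icc (h.continuousOn_du hℓ) hx).congr h.u_eq (h.u_eq x hx)

lemma left (hℓ : -ℓ ≤ ℓ) (h : IsH2Dirichlet ℓ u du d2u) : u (-ℓ) = 0 := by
  rw [h.u_eq (-ℓ) (left_mem_Icc.2 hℓ), intervalIntegral.integral_same]

end IsH2Dirichlet

namespace IsH1Coefficient

lemma continuousOn_mul (ha : IsH1Coefficient ℓ a) (hu : ContinuousOn u (Icc (-ℓ) ℓ)) :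
    ContinuousOn (fun x => (a x : ℂ) * u x) (Icc (-ℓ) ℓ) :=
  (Complex.continuous_ofReal.comp_continuousOn ha.continuousOn).mul hu

lemma countable_not_differentiableAt_mul (ha : IsH1Coefficient ℓ a)
    (hu : ∀ x ∈ Ioo (-ℓ) ℓ, DifferentiableAt ℝ u x) :
    {x ∈ Ioo (-ℓ) ℓ | ¬ DifferentiableAt ℝ (fun y => (a y : ℂ) * u y) x}.Countable := by
  refine ha.countable_not_differentiableAt.mono ?_
  rintro x ⟨hx, hau⟩
  exact ⟨hx, fun hax => hau (hax.hasDerivAt.ofReal_comp.differentiableAt.mul (hu x hx))⟩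

lemma ae_differentiableAt (ha : IsH1Coefficient ℓ a) :
    ∀ᵐ x ∂(volume.restrict (Ioo (-ℓ) ℓ)), x ∈ Ioo (-ℓ) ℓ ∧ DifferentiableAt ℝ a x := by
  filter_upwards [ae_restrict_mem measurableSet_Ioo,
    ae_restrict_of_ae (ha.countable_not_differentiableAt.ae_notMem volume)] with x hx hax
  exact ⟨hx, not_not.1 fun h => hax ⟨hx, h⟩⟩

lemma memLp_deriv_mul (ha : IsH1Coefficient ℓ a) (hdu : ContinuousOn du (Icc (-ℓ) ℓ))
    (hu : ∀ x ∈ Icc (-ℓ) ℓ, HasDerivWithinAt u (du x) (Icc (-ℓ) ℓ) x) :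
    MemLp (deriv fun y => (a y : ℂ) * u y) 2 (volume.restrict (Ioo (-ℓ) ℓ)) := by
  have huc : ContinuousOn u (Icc (-ℓ) ℓ) := fun x hx => (hu x hx).continuousWithinAt
  have hau : MemLp (fun x => u x * ((deriv a x : ℝ) : ℂ)) 2 (volume.restrict (Ioo (-ℓ) ℓ)) :=
    MemLp.mul' (ha.memLp_deriv.ofReal (K := ℂ)) (memLp_Ioo_of_continuousOn ⊤ huc)
  refine (hau.add (memLp_Ioo_of_continuousOn 2 (ha.continuousOn_mul hdu))).ae_eq ?_
  filter_upwards [ha.ae_differentiableAt] with x ⟨hx, hax⟩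
  have hux := (hu x (Ioo_subset_Icc_self hx)).hasDerivAt (Icc_mem_nhds hx.1 hx.2)
  rw [(hax.hasDerivAt.ofReal_comp.fun_mul hux).deriv, Pi.add_apply, mul_comm (u x)]

end IsH1Coefficient

lemma IsH2Dirichlet.hasDerivWithinAt_flux (hℓ : -ℓ ≤ ℓ) (h : IsH2Dirichlet ℓ u du d2u)
    (ha : IsH1Coefficient ℓ a)
    (heq : ∀ᵐ x ∂(volume.restrict (Ioo (-ℓ) ℓ)),
      (ε : ℂ) * d2u x - deriv (fun y => (a y : ℂ) * u y) x = lam * u x)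
    {x : ℝ} (hx : x ∈ Icc (-ℓ) ℓ) :
    HasDerivWithinAt (fun y => ε * du y - a y * u y) (lam * u x) (Icc (-ℓ) ℓ) x := by
  have hu y (hy : y ∈ Icc (-ℓ) ℓ) := h.hasDerivWithinAt hℓ hy
  have huc : ContinuousOn u (Icc (-ℓ) ℓ) := fun y hy => (hu y hy).continuousWithinAt
  have hd2u : IntegrableOn d2u (Icc (-ℓ) ℓ) :=
    (integrableOn_Icc_iff_integrableOn_Ioo).2 (h.memLp.integrable one_le_two)
  have hlamu : ContinuousOn (fun y => lam * u y) (Icc (-ℓ) ℓ) := continuousOn_const.mul huc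
  have hflux : ∀ y ∈ Icc (-ℓ) ℓ, ε * du y - a y * u y =
      ε * du (-ℓ) + ∫ t in (-ℓ)..y, lam * u t := fun y hy => by
    have hsub : Icc (-ℓ) y ⊆ Icc (-ℓ) ℓ := Icc_subset_Icc_right hy.2
    have hau := integral_eq_sub_of_deriv_ae_eq (g := fun t => ε * d2u t - lam * u t)
      (ha.continuousOn_mul huc)
      (ha.countable_not_differentiableAt_mul fun t ht =>
        ((hu t (Ioo_subset_Icc_self ht)).hasDerivAt (Icc_mem_nhds ht.1 ht.2)).differentiableAt)
      (by filter_upwards [heq] with t ht; rw [← ht]; ring)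
      ((hd2u.const_mul (ε : ℂ)).sub hlamu.integrableOn_Icc) hy
    rw [intervalIntegral.integral_sub, intervalIntegral.integral_const_mul, h.left hℓ] at hau
    · linear_combination (ε : ℂ) * h.du_eq y hy + hau
    · exact (intervalIntegrable_iff_integrableOn_Icc_of_le hy.1).2
        (IntegrableOn.mono_set (hd2u.const_mul (ε : ℂ)) hsub)
    · exact (hlamu.mono hsub).intervalIntegrable_of_Icc hy.1
  exact ((hasDerivWithinAt_integral_Icc hlamu hx).const_add _).congr hflux (hflux x hx)

lemma IsEigenfunction.exists_isDirichletSolution (hℓ : -ℓ ≤ ℓ) (hε : ε ≠ 0)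
    (ha : IsH1Coefficient ℓ a) (hρ0 : ∀ x, 0 < ρ x)
    (hρ : ∀ x ∈ Icc (-ℓ) ℓ, HasDerivWithinAt ρ (a x / ε * ρ x) (Icc (-ℓ) ℓ) x)
    (h : IsEigenfunction ℓ ε a lam u) :
    ∃ J, IsDirichletSolution (-ℓ) ℓ (fun x => (ε * ρ x)⁻¹) ρ lam (fun x => u x / ρ x) J := by
  obtain ⟨⟨du, d2u, hH, heq⟩, x₀, hx₀, hux₀⟩ := h
  have hρne x : (ρ x : ℂ) ≠ 0 := Complex.ofReal_ne_zero.2 (hρ0 x).ne'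
  have hεne : (ε : ℂ) ≠ 0 := Complex.ofReal_ne_zero.2 hε
  refine ⟨fun x => ε * du x - a x * u x, ⟨fun x hx => ?_, fun x hx => ?_⟩,
    by simp only [hH.left hℓ, zero_div], by simp only [hH.u_right, zero_div],
    x₀, hx₀, div_ne_zero hux₀ (hρne x₀)⟩
  · convert! (hH.hasDerivWithinAt hℓ hx).fun_div (hρ x hx).ofReal_comp (hρne x) using 1
    have := hρne x
    push_cast
    field_simp
  · convert! hH.hasDerivWithinAt_flux hℓ ha heq hx using 1
    rw [mul_assoc, mul_div_cancel₀ _ (hρne x)]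

lemma IsH1Coefficient.isEigenfunction (hε : ε ≠ 0) (ha : IsH1Coefficient ℓ a)
    (hu : ∀ x ∈ Icc (-ℓ) ℓ, HasDerivWithinAt u ((a x * u x + J x) / ε) (Icc (-ℓ) ℓ) x)
    (hJ : ∀ x ∈ Icc (-ℓ) ℓ, HasDerivWithinAt J (lam * u x) (Icc (-ℓ) ℓ) x)
    (hleft : u (-ℓ) = 0) (hright : u ℓ = 0) (hne : ∃ x ∈ Icc (-ℓ) ℓ, u x ≠ 0) :
    IsEigenfunction ℓ ε a lam u := by
  have hεne : (ε : ℂ) ≠ 0 := Complex.ofReal_ne_zero.2 hε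
  set du : ℝ → ℂ := fun x => (a x * u x + J x) / ε
  set d2u : ℝ → ℂ := fun x => (deriv (fun y => (a y : ℂ) * u y) x + lam * u x) / ε with hd2udef
  have huc : ContinuousOn u (Icc (-ℓ) ℓ) := fun x hx => (hu x hx).continuousWithinAt
  have hJc : ContinuousOn J (Icc (-ℓ) ℓ) := fun x hx => (hJ x hx).continuousWithinAt
  have hduc : ContinuousOn du (Icc (-ℓ) ℓ) := ((ha.continuousOn_mul huc).add hJc).div_const _
  have hud x (hx : x ∈ Ioo (-ℓ) ℓ) : HasDerivAt u (du x) x :=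
    (hu x (Ioo_subset_Icc_self hx)).hasDerivAt (Icc_mem_nhds hx.1 hx.2)
  have hdud x (hx : x ∈ Ioo (-ℓ) ℓ) (hax : DifferentiableAt ℝ a x) : HasDerivAt du (d2u x) x :=
    ((hax.hasDerivAt.ofReal_comp.differentiableAt.mul (hud x hx).differentiableAt).hasDerivAt.add
      ((hJ x (Ioo_subset_Icc_self hx)).hasDerivAt (Icc_mem_nhds hx.1 hx.2))).div_const _
  have hd2u : MemLp d2u 2 (volume.restrict (Ioo (-ℓ) ℓ)) := by
    simp only [hd2udef, div_eq_inv_mul]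
    exact ((ha.memLp_deriv_mul hduc hu).add
      ((memLp_Ioo_of_continuousOn 2 huc).const_mul lam)).const_mul _
  refine ⟨⟨du, d2u, ⟨hd2u, fun x hx => ?_, fun x hx => ?_, hright⟩, ae_of_all _ fun x => ?_⟩, hne⟩
  · rw [integral_eq_sub_of_deriv_ae_eq hduc ?_ ?_ ?_ hx, add_sub_cancel]
    · refine ha.countable_not_differentiableAt.mono ?_
      rintro y ⟨hy, hdu⟩
      exact ⟨hy, fun hay => hdu (hdud y hy hay).differentiableAt⟩
    · filter_upwards [ha.ae_differentiableAt] with y ⟨hy, hay⟩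
      exact (hdud y hy hay).deriv
    · exact (integrableOn_Icc_iff_integrableOn_Ioo).2 (hd2u.integrable one_le_two)
  · have hsub : Icc (-ℓ) x ⊆ Icc (-ℓ) ℓ := Icc_subset_Icc_right hx.2
    rw [intervalIntegral.integral_eq_sub_of_hasDerivAt_of_le hx.1 (huc.mono hsub)
      (fun y hy => hud y ⟨hy.1, hy.2.trans_le hx.2⟩)
      ((hduc.mono hsub).intervalIntegrable_of_Icc hx.1), hleft, sub_zero]
  · rw [hd2udef, mul_div_cancel₀ _ hεne, add_sub_cancel_left]

lemma IsDirichletSolution.isEigenfunction (hε : ε ≠ 0) (ha : IsH1Coefficient ℓ a)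
    (hρ0 : ∀ x, 0 < ρ x)
    (hρ : ∀ x ∈ Icc (-ℓ) ℓ, HasDerivWithinAt ρ (a x / ε * ρ x) (Icc (-ℓ) ℓ) x)
    (h : IsDirichletSolution (-ℓ) ℓ (fun x => (ε * ρ x)⁻¹) ρ lam v J) :
    IsEigenfunction ℓ ε a lam (fun x => ρ x * v x) := by
  have hρne x : (ρ x : ℂ) ≠ 0 := Complex.ofReal_ne_zero.2 (hρ0 x).ne'
  have hεne : (ε : ℂ) ≠ 0 := Complex.ofReal_ne_zero.2 hε
  obtain ⟨x₀, hx₀, hvx₀⟩ := h.ne_zero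
  refine ha.isEigenfunction hε (J := J) (fun x hx => ?_) (fun x hx => ?_)
    (by rw [h.left, mul_zero]) (by rw [h.right, mul_zero]) ⟨x₀, hx₀, mul_ne_zero (hρne x₀) hvx₀⟩
  · convert! (hρ x hx).ofReal_comp.fun_mul (h.hasDerivWithinAt_fst x hx) using 1
    have := hρne x
    push_cast
    field_simp
  · rw [← mul_assoc]
    exact h.hasDerivWithinAt_snd x hx

lemma isEigenvalue_iff (hℓ : -ℓ ≤ ℓ) (hε : ε ≠ 0) (ha : IsH1Coefficient ℓ a) (hρ0 : ∀ x, 0 < ρ x)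
    (hρ : ∀ x ∈ Icc (-ℓ) ℓ, HasDerivWithinAt ρ (a x / ε * ρ x) (Icc (-ℓ) ℓ) x) :
    IsEigenvalue ℓ ε a lam ↔ IsDirichletEigenvalue (-ℓ) ℓ (fun x => (ε * ρ x)⁻¹) ρ lam :=
  ⟨fun ⟨_, hu⟩ => ⟨_, hu.exists_isDirichletSolution hℓ hε ha hρ0 hρ⟩,
    fun ⟨_, _, hv⟩ => ⟨_, hv.isEigenfunction hε ha hρ0 hρ⟩⟩

lemma IsH1Coefficient.isSimple (hℓ : -ℓ ≤ ℓ) (hε : ε ≠ 0) (ha : IsH1Coefficient ℓ a) :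
    IsSimple ℓ ε a lam := by
  intro u w hu hw
  obtain ⟨ρ, hρ0, hρ⟩ := exists_pos_hasDerivWithinAt_eq_mul (ha.continuousOn.div_const ε)
  have hρc : ContinuousOn ρ (Icc (-ℓ) ℓ) := fun x hx => (hρ x hx).continuousWithinAt
  have hPc : ContinuousOn (fun x => (ε * ρ x)⁻¹) (Icc (-ℓ) ℓ) :=
    (continuousOn_const.mul hρc).inv₀ fun x _ => mul_ne_zero hε (hρ0 x).ne'
  obtain ⟨J, hJ⟩ := hu.exists_isDirichletSolution hℓ hε ha hρ0 hρ
  obtain ⟨K, hK⟩ := hw.exists_isDirichletSolution hℓ hε ha hρ0 hρ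
  obtain ⟨c, hc⟩ := hJ.exists_eq_const_mul hPc hρc hK.toIsSolution hK.left
  refine ⟨c, fun x hx => ?_⟩
  have hρne : (ρ x : ℂ) ≠ 0 := Complex.ofReal_ne_zero.2 (hρ0 x).ne'
  have := hc x hx
  rwa [mul_div_assoc', div_left_inj' hρne] at this

end Operator

/-! ### Coefficients satisfying A1 and A2 -/

namespace HypA1

variable {ℓ ξ x : ℝ} {a : ℝ → ℝ}

lemma sub_mul_nonpos (h : HypA1 ℓ ξ a) (hx : x ∈ Ioo (-ℓ) ℓ) : (x - ξ) * a x ≤ 0 := by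
  rcases lt_trichotomy x ξ with hlt | rfl | hgt
  · exact mul_nonpos_of_nonpos_of_nonneg (sub_nonpos.2 hlt.le) (h.left x ⟨hx.1, hlt⟩).2.2.le
  · simp only [sub_self, zero_mul, le_refl]
  · exact mul_nonpos_of_nonneg_of_nonpos (sub_nonneg.2 hgt.le) (h.right x ⟨hgt, hx.2⟩).1.le

lemma concaveOn (h : HypA1 ℓ ξ a) (hξ : ξ ≤ ℓ) (hc : ContinuousOn a (Icc (-ℓ) ℓ)) :
    ConcaveOn ℝ (Ioc (-ℓ) ξ) a := by
  have hsub : Ioo (-ℓ) ξ ⊆ Ioo (-ℓ) ℓ := Ioo_subset_Ioo_right hξ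
  refine concaveOn_of_deriv2_nonpos (convex_Ioc _ _)
    (hc.mono (Ioc_subset_Icc_self.trans (Icc_subset_Icc_right hξ))) ?_ ?_ ?_ <;>
    rw [interior_Ioc]
  · exact fun x hx => (h.differentiable x (hsub hx) hx.2.ne).differentiableWithinAt
  · exact fun x hx => (h.twice_differentiable x (hsub hx) hx.2.ne).differentiableWithinAt
  · exact fun x hx => (h.left x hx).2.1.le

lemma convexOn (h : HypA1 ℓ ξ a) (hξ : -ℓ ≤ ξ) (hc : ContinuousOn a (Icc (-ℓ) ℓ)) :
    ConvexOn ℝ (Ico ξ ℓ) a := by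
  have hsub : Ioo ξ ℓ ⊆ Ioo (-ℓ) ℓ := Ioo_subset_Ioo_left hξ
  refine convexOn_of_deriv2_nonneg (convex_Ico _ _)
    (hc.mono (Ico_subset_Icc_self.trans (Icc_subset_Icc_left hξ))) ?_ ?_ ?_ <;>
    rw [interior_Ico]
  · exact fun x hx => (h.differentiable x (hsub hx) hx.1.ne').differentiableWithinAt
  · exact fun x hx => (h.twice_differentiable x (hsub hx) hx.1.ne').differentiableWithinAt
  · exact fun x hx => (h.right x hx).2.2.le

lemma min_derivWithin_le_deriv (h : HypA1 ℓ ξ a) (hξ : ξ ∈ Ioo (-ℓ) ℓ)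
    (hc : ContinuousOn a (Icc (-ℓ) ℓ)) (hl : DifferentiableWithinAt ℝ a (Iic ξ) ξ)
    (hr : DifferentiableWithinAt ℝ a (Ici ξ) ξ) (hx : x ∈ Ioo (-ℓ) ℓ) (hxξ : x ≠ ξ) :
    min (derivWithin a (Iic ξ) ξ) (derivWithin a (Ici ξ) ξ) ≤ deriv a x := by
  have hd : DifferentiableAt ℝ a x := h.differentiable x hx hxξ
  rcases hxξ.lt_or_gt with hlt | hgt
  · have hconc := h.concaveOn hξ.2.le hc
    have hxm : x ∈ Ioc (-ℓ) ξ := ⟨hx.1, hlt.le⟩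
    have hξm : ξ ∈ Ioc (-ℓ) ξ := ⟨hξ.1, le_rfl⟩
    calc min (derivWithin a (Iic ξ) ξ) (derivWithin a (Ici ξ) ξ)
        ≤ derivWithin a (Iic ξ) ξ := min_le_left _ _
      _ ≤ slope a x ξ := hconc.le_slope_of_hasDerivWithinAt_Iio hxm hξm hlt
          (hl.hasDerivWithinAt.mono Iio_subset_Iic_self)
      _ ≤ deriv a x := hconc.slope_le_deriv hxm hξm hlt hd
  · have hconv := h.convexOn hξ.1.le hc
    have hξm : ξ ∈ Ico ξ ℓ := ⟨le_rfl, hξ.2⟩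
    have hxm : x ∈ Ico ξ ℓ := ⟨hgt.le, hx.2⟩
    calc min (derivWithin a (Iic ξ) ξ) (derivWithin a (Ici ξ) ξ)
        ≤ derivWithin a (Ici ξ) ξ := min_le_right _ _
      _ ≤ slope a ξ x := hconv.le_slope_of_hasDerivWithinAt_Ioi hξm hxm hgt
          (hr.hasDerivWithinAt.mono Ioi_subset_Ici_self)
      _ ≤ deriv a x := hconv.slope_le_deriv hξm hxm hgt hd

lemma deriv_neg (h : HypA1 ℓ ξ a) (hx : x ∈ Ioo (-ℓ) ℓ) (hxξ : x ≠ ξ) : deriv a x < 0 :=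
  hxξ.lt_or_gt.elim (fun hlt => (h.left x ⟨hx.1, hlt⟩).1) fun hgt => (h.right x ⟨hgt, hx.2⟩).2.1

lemma isH1Coefficient (h : HypA1 ℓ ξ a) (hξ : ξ ∈ Ioo (-ℓ) ℓ)
    (hc : ContinuousOn a (Icc (-ℓ) ℓ)) (hl : DifferentiableWithinAt ℝ a (Iic ξ) ξ)
    (hr : DifferentiableWithinAt ℝ a (Ici ξ) ξ) : IsH1Coefficient ℓ a where
  continuousOn := hc
  countable_not_differentiableAt := (countable_singleton ξ).mono fun x hx =>
    by_contra fun hxξ => hx.2 (h.differentiable x hx.1 hxξ)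
  memLp_deriv := by
    refine MemLp.of_bound (measurable_deriv a).aestronglyMeasurable
      (-min (derivWithin a (Iic ξ) ξ) (derivWithin a (Ici ξ) ξ)) ?_
    filter_upwards [ae_restrict_mem measurableSet_Ioo,
      (countable_singleton ξ).ae_notMem (volume.restrict (Ioo (-ℓ) ℓ))] with x hx hxξ
    rw [Real.norm_of_nonpos (h.deriv_neg hx hxξ).le]
    exact neg_le_neg (h.min_derivWithin_le_deriv hξ hc hl hr hx hxξ)

end HypA1

lemma HypA2.exists_le_abs {ℓ ξ am ap ε₁ : ℝ} {a : ℝ → ℝ → ℝ} (h : HypA2 ℓ ξ am ap ε₁ a)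
    (ham : am ≠ 0) (hap : ap ≠ 0) :
    ∃ m c : ℝ, 0 < m ∧ ∀ ε ∈ Ioo 0 ε₁, ∀ x ∈ Ioo (-ℓ) ℓ, c * ε ≤ |x - ξ| → m ≤ |a ε x| := by
  set m := min |am| |ap| / 2 with hm
  have hm0 : 0 < m := half_pos (lt_min (abs_pos.2 ham) (abs_pos.2 hap))
  have hstep : ∀ x, 2 * m ≤ |stepFunction ξ am ap x| := fun x => by
    rw [hm, mul_div_cancel₀ _ two_ne_zero, stepFunction]
    split_ifs
    exacts [min_le_left _ _, min_le_right _ _]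
  obtain ⟨c, -, hc⟩ := h m hm0
  refine ⟨m, c, hm0, fun ε hε x hx hcx => ?_⟩
  have hclose := (hc ε hε x hx hcx).1
  have htri := abs_sub_abs_le_abs_sub (stepFunction ξ am ap x) (a ε x)
  rw [abs_sub_comm] at htri
  linarith [hstep x]

/-! ### The second eigenvalue -/

theorem exists_isSecondEigenvalue_le {ℓ ξ ε m c : ℝ} (hℓ : 0 < ℓ) (hε : 0 < ε) (hm : 0 ≤ m)
    {a : ℝ → ℝ} (ha : IsH1Coefficient ℓ a) (hsign : ∀ x ∈ Ioo (-ℓ) ℓ, (x - ξ) * a x ≤ 0)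
    (hfar : ∀ x ∈ Ioo (-ℓ) ℓ, c * ε ≤ |x - ξ| → m ≤ |a x|) :
    ∃ lam₂ : ℝ, IsSecondEigenvalue ℓ ε a lam₂ ∧
      lam₂ ≤ -(min (Real.exp (-c)) m ^ 2 / 16 / ε) := by
  have hℓ' : -ℓ < ℓ := neg_lt_self hℓ
  obtain ⟨ρ, hρ0, hρ⟩ := exists_pos_hasDerivWithinAt_eq_mul (ha.continuousOn.div_const ε)
  have hρc : ContinuousOn ρ (Icc (-ℓ) ℓ) := HasDerivWithinAt.continuousOn hρ
  have hP0 : ∀ x, 0 < (ε * ρ x)⁻¹ := fun x => inv_pos.2 (mul_pos hε (hρ0 x))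
  have hiff lam := isEigenvalue_iff (lam := lam) hℓ'.le hε.ne' ha hρ0 hρ
  obtain ⟨lam₁, lam₂, hlt, h₁, h₂, hrest, z, hz, hleft, hright⟩ :=
    exists_second_isDirichletEigenvalue hℓ'
      ((continuousOn_const.mul hρc).inv₀ fun x _ => (mul_pos hε (hρ0 x)).ne') hρc
      (fun x _ => hP0 x) fun x _ => hρ0 x
  refine ⟨lam₂, ⟨(hiff _).2 h₂, lam₁, hlt, (hiff _).2 h₁, ha.isSimple hℓ'.le hε.ne',
    fun ν hν => hrest ν ((hiff ν).1 hν)⟩, ?_⟩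
  rcases le_total z ξ with hzξ | hξz
  · have hsub : Ioo (-ℓ) z ⊆ Ioo (-ℓ) ℓ := Ioo_subset_Ioo_right hz.2
    have hsub' : Icc (-ℓ) z ⊆ Icc (-ℓ) ℓ := Icc_subset_Icc_right hz.2
    exact hleft.re_le_of_one_side hε hm abs_one hρ0 (fun x hx => (hρ x (hsub' hx)).mono hsub')
      (fun x hx => by linarith [hx.2]) (fun x hx => hsign x (hsub hx))
      fun x hx => hfar x (hsub hx)
  · have hsub : Ioo z ℓ ⊆ Ioo (-ℓ) ℓ := Ioo_subset_Ioo_left hz.1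
    have hsub' : Icc z ℓ ⊆ Icc (-ℓ) ℓ := Icc_subset_Icc_left hz.1
    exact hright.re_le_of_one_side hε hm (σ := -1) (by simp) hρ0
      (fun x hx => (hρ x (hsub' hx)).mono hsub') (fun x hx => by linarith [hx.1])
      (fun x hx => hsign x (hsub hx)) fun x hx => hfar x (hsub hx)

end DiffusionTransport

theorem proposition4p3_general {ℓ ξ ε₁ m c : ℝ} (hℓ : 0 < ℓ) (hm : 0 < m) {a : ℝ → ℝ → ℝ}
    (ha : ∀ ε ∈ Ioo 0 ε₁, DiffusionTransport.IsH1Coefficient ℓ (a ε))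
    (hsign : ∀ ε ∈ Ioo 0 ε₁, ∀ x ∈ Ioo (-ℓ) ℓ, (x - ξ) * a ε x ≤ 0)
    (hfar : ∀ ε ∈ Ioo 0 ε₁, ∀ x ∈ Ioo (-ℓ) ℓ, c * ε ≤ |x - ξ| → m ≤ |a ε x|) :
    ∃ C : ℝ, 0 < C ∧ ∀ ε ∈ Ioo 0 ε₁, ∃ lam₂ : ℝ,
      DiffusionTransport.IsSecondEigenvalue ℓ ε (a ε) lam₂ ∧ lam₂ ≤ -C / ε := by
  refine ⟨min (Real.exp (-c)) m ^ 2 / 16, by positivity, fun ε hε => ?_⟩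
  rw [neg_div]
  exact DiffusionTransport.exists_isSecondEigenvalue_le hℓ hε.1 hm.le (ha ε hε) (hsign ε hε)
    (hfar ε hε)

theorem proposition4p3 (ℓ ξ am ap ε₁ : ℝ) (hξ : ξ ∈ Set.Ioo (-ℓ) ℓ) (hap : ap < 0) (ham : 0 < am)
    (hε₁ : 0 < ε₁) (a : ℝ → ℝ → ℝ)
    (hcont : ∀ ε ∈ Set.Ioo 0 ε₁, ContinuousOn (a ε) (Set.Icc (-ℓ) ℓ))
    (hA1 : ∀ ε ∈ Set.Ioo 0 ε₁, DiffusionTransport.HypA1 ℓ ξ (a ε))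
    (hA2 : DiffusionTransport.HypA2 ℓ ξ am ap ε₁ a)
    (hA3 : DiffusionTransport.HypA3 ξ ε₁ a) :
    ∃ C : ℝ, 0 < C ∧ ∃ ε₀ : ℝ, 0 < ε₀ ∧ ε₀ ≤ ε₁ ∧ ∀ ε ∈ Set.Ioo 0 ε₀,
      ∃ lam₂ : ℝ, DiffusionTransport.IsSecondEigenvalue ℓ ε (a ε) lam₂ ∧ lam₂ ≤ -C / ε := by
  obtain ⟨m, c, hm, hfar⟩ := hA2.exists_le_abs ham.ne' hap.ne
  obtain ⟨C, hC, h⟩ := proposition4p3_general (by linarith [hξ.1, hξ.2]) hm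
    (fun ε hε => (hA1 ε hε).isH1Coefficient hξ (hcont ε hε) (hA3.left_differentiable ε hε)
      (hA3.right_differentiable ε hε))
    (fun ε hε _ hx => (hA1 ε hε).sub_mul_nonpos hx) hfar
  exact ⟨C, hC, ε₁, hε₁, le_rfl, h⟩
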